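/- Let $G$ be a finite group, let $\alpha \in Z^2(G,\mathbb{C}^*)$ be a $2$-cocycle (for the trivial action of $G$ on $\mathbb{C}^*$), let $n$ be the order of its class $[\alpha]$ in the Schur multiplier $M(G) = H^2(G,\mathbb{C}^*)$, and let $r \ge 0$ be an integer. Write $\mathbb{C}^{\alpha}G$ for the twisted group algebra, that is, the $\mathbb{C}$-vector space with basis $\{u_g\}_{g\in G}$ and bilinear multiplication given by $u_g u_h = \alpha(g,h)u_{gh}$. An $\alpha$-representation of $G$ on a finite-dimensional complex vector space $V$ is a map $\eta : G \to \mathrm{GL}(V)$ with $\eta(g)\eta(h) = \alpha(g,h)\eta(gh)$ for all $g,h \in G$; it is irreducible if $V \ne 0$ and $V$ has no $G$-invariant subspaces other than $0$ and $V$. Let $c_{G,\alpha}$ be the greatest common divisor of the dimensions of the irreducible $\alpha$-representations of $G$. 1. If $\gcd(r,n) = 1$, then $\mathbb{C}^{\alpha}G \cong \mathbb{C}^{\alpha^r}G$ (as $\mathbb{C}$-algebras, hence also as rings). 2. If $\gcd(r,n) \neq 1$, then $c_{G,\alpha} > c_{G,\alpha^r}$. 3. In particular, $\mathbb{C}^{\alpha}G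 \cong \mathbb{C}^{\alpha^r}G$ if and only if $\gcd(n,r)=1$; this holds both for isomorphism of $\mathbb{C}$-algebras and for isomorphism of rings. -/

import Mathlib

namespace TwistedGroup

open groupCohomology

/-- The trivial `G`-module `Rˣ`, written additively. -/
abbrev unitsRep (R : Type) [CommRing R] (G : Type) [Group G] : Rep ℤ G :=
  Rep.trivial ℤ G (Additive Rˣ)

/-- `Z²(G, Rˣ)`, for the trivial action of `G` on `Rˣ`. The group is written additively: the
power `α ^ r` of a cocycle `α` is `r • α`. -/
abbrev Cocycle (R : Type) [CommRing R] (G : Type) [Group G] : Type :=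
  cocycles₂ (unitsRep R G)

/-- `H²(G, Rˣ)`, for the trivial action of `G` on `Rˣ`, written additively.
For `R = ℂ` this is the Schur multiplier `M(G)`. -/
noncomputable abbrev Cohomology (R : Type) [CommRing R] (G : Type) [Group G] :=
  H2 (unitsRep R G)

namespace Cocycle

variable {R : Type} [CommRing R] {G : Type} [Group G]

/-- The value `α(g, h) ∈ Rˣ` of a 2-cocycle. -/
def val (α : Cocycle R G) (g h : G) : Rˣ := Additive.toMul (α.1 (g, h) : Additive Rˣ)

/-- The class `[α] ∈ H²(G, Rˣ)`. -/
noncomputable def cls (α : Cocycle R G) : Cohomology R G := H2π (unitsRep R G) α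

theorem val_mul (α : Cocycle R G) (g h j : G) :
    α.val (g * h) j * α.val g h = α.val h j * α.val g (h * j) :=
  (mem_cocycles₂_iff (A := unitsRep R G) α.1).1 α.2 g h j

theorem val_nsmul (α : Cocycle R G) (r : ℕ) (g h : G) :
    Cocycle.val (r • α) g h = (α.val g h) ^ r := rfl

theorem val_one_fst (α : Cocycle R G) (g : G) : α.val 1 g = α.val 1 1 := by
  have h := α.val_mul 1 1 g
  simp only [one_mul] at h
  exact (mul_left_cancel h).symm

theorem val_one_snd (α : Cocycle R G) (g : G) : α.val g 1 = α.val 1 1 := by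
  have h := α.val_mul g 1 1
  simp only [mul_one] at h
  exact mul_right_cancel h

end Cocycle

/-- The twisted group algebra `R^α G`: the free `R`-module with basis `u_g` (`g ∈ G`), with the
`R`-bilinear multiplication determined by `u_g u_h = α(g, h) u_{gh}`. -/
def TwistedGroupAlgebra {R : Type} [CommRing R] {G : Type} [Group G]
    (_α : Cocycle R G) : Type := G →₀ R

namespace TwistedGroupAlgebra

variable {R : Type} [CommRing R] {G : Type} [Group G] (α : Cocycle R G)

noncomputable instance : AddCommGroup (TwistedGroupAlgebra α) :=
  inferInstanceAs (AddCommGroup (G →₀ R))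

noncomputable instance : Module R (TwistedGroupAlgebra α) :=
  inferInstanceAs (Module R (G →₀ R))

/-- The basis `(u_g)` of `R^α G`. -/
noncomputable def u : Module.Basis G R (TwistedGroupAlgebra α) :=
  Module.Basis.ofRepr (LinearEquiv.refl R (G →₀ R))

/-- The multiplication of `R^α G` as a bilinear map. -/
noncomputable def mulMap :
    TwistedGroupAlgebra α →ₗ[R] TwistedGroupAlgebra α →ₗ[R] TwistedGroupAlgebra α :=
  (u α).constr R fun g => (u α).constr R fun h => (α.val g h : R) • u α (g * h)

noncomputable instance : Mul (TwistedGroupAlgebra α) := ⟨fun x y => mulMap α x y⟩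

/-- The unit element `α(1, 1)⁻¹ u_1`. -/
noncomputable instance : One (TwistedGroupAlgebra α) :=
  ⟨(((α.val 1 1)⁻¹ : Rˣ) : R) • u α 1⟩

theorem mul_def (x y : TwistedGroupAlgebra α) : x * y = mulMap α x y := rfl

theorem one_def : (1 : TwistedGroupAlgebra α) = (((α.val 1 1)⁻¹ : Rˣ) : R) • u α 1 := rfl

theorem u_mul_u (g h : G) : u α g * u α h = (α.val g h : R) • u α (g * h) := by
  simp [mul_def, mulMap, Module.Basis.constr_basis]

theorem one_mul_aux : mulMap α 1 = LinearMap.id := by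
  refine (u α).ext fun g => ?_
  have h := u_mul_u α 1 g
  rw [mul_def] at h
  rw [one_def, map_smul, LinearMap.smul_apply, h, α.val_one_fst g, smul_smul]
  simp

theorem mul_one_aux : (mulMap α).flip 1 = LinearMap.id := by
  refine (u α).ext fun g => ?_
  have h := u_mul_u α g 1
  rw [mul_def] at h
  rw [LinearMap.flip_apply, one_def, map_smul, h, α.val_one_snd g, smul_smul]
  simp

theorem mul_assoc_aux :
    (mulMap α).compr₂ (mulMap α) =
      ((LinearMap.llcomp R _ _ _).flip (mulMap α)).comp
        ((LinearMap.llcomp R _ _ _).comp (mulMap α)) := by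
  refine (u α).ext fun g => (u α).ext fun h => (u α).ext fun j => ?_
  have key : u α g * u α h * u α j = u α g * (u α h * u α j) := by
    have hc := congrArg (Units.val) (α.val_mul g h j)
    simp only [Units.val_mul] at hc
    rw [u_mul_u, u_mul_u, mul_def, mul_def, map_smul, map_smul, LinearMap.smul_apply,
      ← mul_def, ← mul_def, u_mul_u, u_mul_u, smul_smul, smul_smul, mul_assoc g h j,
      mul_comm (α.val g h : R), hc]
  simpa [mul_def] using key

noncomputable instance : Ring (TwistedGroupAlgebra α) :=
  { (inferInstance : AddCommGroup (TwistedGroupAlgebra α)),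
    (inferInstance : Mul (TwistedGroupAlgebra α)),
    (inferInstance : One (TwistedGroupAlgebra α)) with
    left_distrib := fun x y z => map_add (mulMap α x) y z
    right_distrib := fun x y z => by simp [mul_def]
    zero_mul := fun x => by simp [mul_def]
    mul_zero := fun x => by simp [mul_def]
    one_mul := fun x => DFunLike.congr_fun (one_mul_aux α) x
    mul_one := fun x => DFunLike.congr_fun (mul_one_aux α) x
    mul_assoc := fun x y z => DFunLike.congr_fun
      (DFunLike.congr_fun (DFunLike.congr_fun (mul_assoc_aux α) x) y) z }

noncomputable instance : Algebra R (TwistedGroupAlgebra α) :=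
  Algebra.ofModule (fun r x y => by simp [mul_def]) (fun r x y => by simp [mul_def])

end TwistedGroupAlgebra

/-- An `α`-representation of `G` on the `F`-vector space `V`: a map `η : G → GL(V)` with
`η(g) η(h) = α(g, h) η(gh)`. -/
structure ProjRep {F : Type} [Field F] {G : Type} [Group G] (α : Cocycle F G)
    (V : Type*) [AddCommGroup V] [Module F V] where
  toFun : G → LinearMap.GeneralLinearGroup F V
  map_mul : ∀ g h : G, ((toFun g : V →ₗ[F] V)) * (toFun h : V →ₗ[F] V) =
    (α.val g h : F) • (toFun (g * h) : V →ₗ[F] V)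

/-- `η` is irreducible: `V ≠ 0`, and `V` has no invariant subspaces except `0` and `V`. -/
def ProjRep.IsIrreducible {F : Type} [Field F] {G : Type} [Group G] {α : Cocycle F G}
    {V : Type*} [AddCommGroup V] [Module F V] (η : ProjRep α V) : Prop :=
  Nontrivial V ∧ ∀ W : Submodule F V,
    (∀ g : G, ∀ w ∈ W, (η.toFun g : V →ₗ[F] V) w ∈ W) → W = ⊥ ∨ W = ⊤

/-- The set of the dimensions of the irreducible (finite-dimensional) `α`-representations. -/
def irrDims {F : Type} [Field F] {G : Type} [Group G] (α : Cocycle F G) : Set ℕ :=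
  {d | ∃ (V : Type) (_ : AddCommGroup V) (_ : Module F V) (_ : FiniteDimensional F V)
    (η : ProjRep α V), η.IsIrreducible ∧ Module.finrank F V = d}

/-- The greatest common divisor of a set of natural numbers (`0` if there is no positive
element in it). -/
noncomputable def setGcd (S : Set ℕ) : ℕ := sSup {d | ∀ m ∈ S, d ∣ m}

theorem dvd_setGcd_iff (S : Set ℕ) (d : ℕ) : d ∣ setGcd S ↔ ∀ m ∈ S, d ∣ m := by
  by_cases hS : ∃ m ∈ S, m ≠ 0
  · obtain ⟨m, hm, hm0⟩ := hS
    have hbdd : BddAbove {d | ∀ m ∈ S, d ∣ m} :=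
      ⟨m, fun d hd => Nat.le_of_dvd (Nat.pos_of_ne_zero hm0) (hd m hm)⟩
    have hmem : ∀ m ∈ S, setGcd S ∣ m :=
      Nat.sSup_mem (s := {d | ∀ m ∈ S, d ∣ m}) ⟨1, fun m _ => one_dvd m⟩ hbdd
    refine ⟨fun h m hm => h.trans (hmem m hm), fun h => ?_⟩
    have hl : Nat.lcm d (setGcd S) ≤ setGcd S :=
      le_csSup hbdd (fun m hm => Nat.lcm_dvd (h m hm) (hmem m hm))
    have hpos : 0 < setGcd S := Nat.pos_of_dvd_of_pos (hmem m hm) (Nat.pos_of_ne_zero hm0)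
    have heq : Nat.lcm d (setGcd S) = setGcd S :=
      le_antisymm hl (Nat.le_of_dvd (Nat.lcm_pos
        (Nat.pos_of_dvd_of_pos (h m hm) (Nat.pos_of_ne_zero hm0)) hpos) (Nat.dvd_lcm_right _ _))
    exact heq ▸ Nat.dvd_lcm_left d (setGcd S)
  · push Not at hS
    have h0 : setGcd S = 0 := by
      refine Nat.sSup_of_not_bddAbove ?_
      rintro ⟨b, hb⟩
      have : b + 1 ≤ b := hb (fun m hm => (hS m hm) ▸ dvd_zero (b + 1))
      omega
    exact ⟨fun _ m hm => (hS m hm) ▸ dvd_zero d, fun _ => h0 ▸ dvd_zero d⟩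

/-- `c_{G,α}`: the greatest common divisor of the dimensions of the irreducible
`α`-representations of `G`. -/
noncomputable def dimGcd {F : Type} [Field F] {G : Type} [Group G] (α : Cocycle F G) : ℕ :=
  setGcd (irrDims α)

end TwistedGroup

/-! For `r` coprime to `n`: `α` is cohomologous to a cocycle `β` with values in the `n`-th roots of
unity, and some field automorphism `σ` raises these roots to the power `r`. Applying `σ` to
coefficients gives a `σ`-semilinear ring isomorphism from the algebra of `β` to that of `β ^ r`. By
Maschke and Wedderburn the source is a product of matrix algebras, so `σ⁻¹` on matrix entries
corrects it to an algebra isomorphism.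

Otherwise, compare `q`-adic valuations for each prime `q`. Pick an irreducible `V` of dimension `d`
with `v_q(d) = v_q(c_{G,α}) = a`. The exterior power `Λ^i V` is an `α ^ i`-representation, and
`v_q(C(d,i)) = a - v_q(i)` for `1 ≤ i ≤ q^a`. For `i = q^a` this is `0`, so tensoring with `Λ^{q^a}
V` shifts the exponent by `q^a` at no cost: only `r` modulo `q^a` matters. Hence `c_{G,α^r}` divides
`c_{G,α}`, with a strict drop at any `q` dividing `r` and `n` (`dimGcd_dvd_choose`,
`factorization_dimGcd_nsmul`).

For the converse, `c_{G,α}` is a ring invariant: by Schur, the dimension of a simple module over its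
endomorphism ring is its dimension over the field (`mem_irrDims_iff`). -/

open groupCohomology Module TensorProduct

namespace TwistedGroup

/-! ### Cocycles and coboundaries -/

namespace Cocycle

variable {R : Type} [CommRing R] {G : Type} [Group G]

theorem val_add (α β : Cocycle R G) (g h : G) : (α + β).val g h = α.val g h * β.val g h := rfl

/-- A cocycle has trivial class iff it is the coboundary of a function `f : G → Rˣ`. -/
theorem cls_eq_zero_iff (α : Cocycle R G) :
    α.cls = 0 ↔ ∃ f : G → Rˣ, ∀ g h, f g * f h = α.val g h * f (g * h) := by
  rw [cls, H2π_eq_zero_iff]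
  constructor
  · rintro ⟨f, hf⟩
    refine ⟨fun g => Additive.toMul (f g : Additive Rˣ), fun g h => ?_⟩
    have h1 := congrFun hf (g, h)
    have h2 : (f h : Additive Rˣ) - f (g * h) + f g = α.1 (g, h) := h1
    have h3 : (f g : Additive Rˣ) + f h = α.1 (g, h) + f (g * h) := by
      rw [← h2]; abel
    exact h3
  · rintro ⟨f, hf⟩
    refine ⟨fun g => Additive.ofMul (f g), funext fun ⟨g, h⟩ => ?_⟩
    have h3 : (Additive.ofMul (f g)) + Additive.ofMul (f h) =
      (α.1 (g, h) : Additive Rˣ) + Additive.ofMul (f (g * h)) := hf g h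
    have : Additive.ofMul (f h) - Additive.ofMul (f (g * h)) + Additive.ofMul (f g) =
      (α.1 (g, h) : Additive Rˣ) := by
      rw [sub_add_eq_add_sub, add_comm (Additive.ofMul (f h)), h3]; abel
    exact this

theorem cls_nsmul (α : Cocycle R G) (r : ℕ) : (r • α).cls = r • α.cls := by
  simp [cls]

/-- The coboundary of `f : G → Rˣ`. -/
noncomputable def coboundary (f : G → Rˣ) : Cocycle R G :=
  ⟨fun p => Additive.ofMul (f p.1 * f p.2 / f (p.1 * p.2)),
    (mem_cocycles₂_iff (A := unitsRep R G) _).2 fun g h j => by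
      change f (g * h) * f j / f (g * h * j) * (f g * f h / f (g * h)) =
        f h * f j / f (h * j) * (f g * f (h * j) / f (g * (h * j)))
      rw [mul_assoc g h j]
      simp only [div_eq_mul_inv]
      rw [show f (g * h) * f j * (f (g * (h * j)))⁻¹ * (f g * f h * (f (g * h))⁻¹) =
        f g * f h * f j * (f (g * (h * j)))⁻¹ * (f (g * h) * (f (g * h))⁻¹) by
          ac_rfl,
        show f h * f j * (f (h * j))⁻¹ * (f g * f (h * j) * (f (g * (h * j)))⁻¹) =
        f g * f h * f j * (f (g * (h * j)))⁻¹ * (f (h * j) * (f (h * j))⁻¹) by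
          ac_rfl]
      simp⟩

end Cocycle

theorem TwistedGroupAlgebra.u_one {R : Type} [CommRing R] {G : Type} [Group G] (α : Cocycle R G) :
    u α 1 = (α.val 1 1 : R) • (1 : TwistedGroupAlgebra α) := by
  rw [one_def, smul_smul, Units.mul_inv, one_smul]

/-! ### Constructions of projective representations -/

namespace ProjRep

variable {F : Type} [Field F] {G : Type} [Group G] {α β : Cocycle F G}
variable {V W : Type*} [AddCommGroup V] [Module F V] [AddCommGroup W] [Module F W]

/-- An `α`-representation from endomorphisms not assumed to be invertible, except at `1`. -/
def ofEnd (α : Cocycle F G) (f : G → V →ₗ[F] V) (h1 : f 1 = (α.val 1 1 : F) • LinearMap.id)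
    (hf : ∀ g h, f g * f h = (α.val g h : F) • f (g * h)) : ProjRep α V where
  toFun g :=
    { val := f g
      inv := ((α.val g g⁻¹ * α.val 1 1)⁻¹ : Fˣ) • f g⁻¹
      val_inv := by
        rw [mul_smul_comm, hf, mul_inv_cancel, h1, Units.smul_def, smul_smul, smul_smul,
          ← Units.val_mul, ← Units.val_mul, mul_assoc, inv_mul_cancel, Units.val_one, one_smul]
        rfl
      inv_val := by
        have hs : α.val g⁻¹ g = α.val g g⁻¹ := by
          have h := α.val_mul g g⁻¹ g
          rw [mul_inv_cancel, inv_mul_cancel, α.val_one_fst, α.val_one_snd g, mul_comm] at h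
          exact (mul_right_cancel h).symm
        rw [smul_mul_assoc, hf, inv_mul_cancel, h1, hs, Units.smul_def, smul_smul, smul_smul,
          ← Units.val_mul, ← Units.val_mul, mul_assoc, inv_mul_cancel, Units.val_one, one_smul]
        rfl }
  map_mul := hf

/-- The endomorphism `η(g)`. -/
def op (η : ProjRep α V) (g : G) : V →ₗ[F] V := η.toFun g

theorem op_mul (η : ProjRep α V) (g h : G) :
    η.op g * η.op h = (α.val g h : F) • η.op (g * h) := η.map_mul g h

theorem op_op (η : ProjRep α V) (g h : G) (v : V) :
    η.op g (η.op h v) = (α.val g h : F) • η.op (g * h) v := LinearMap.congr_fun (η.op_mul g h) v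

theorem op_one (η : ProjRep α V) : η.op 1 = (α.val 1 1 : F) • LinearMap.id := by
  have h := η.op_mul 1 1
  rw [mul_one] at h
  have hu : IsUnit (η.op 1) := (η.toFun 1).isUnit
  refine hu.mul_left_cancel ?_
  rw [h, mul_smul_comm]
  rfl

/-- The restriction of `η` to an invariant subspace. -/
def sub (η : ProjRep α V) (U : Submodule F V) (hU : ∀ g, ∀ w ∈ U, η.op g w ∈ U) :
    ProjRep α U :=
  ofEnd α (fun g => (η.op g).restrict (hU g))
    (by ext v; simp [LinearMap.restrict_apply, η.op_one])
    (fun g h => by ext v; simp [LinearMap.restrict_apply, η.op_op])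

/-- The quotient of `η` by an invariant subspace. -/
def quot (η : ProjRep α V) (U : Submodule F V) (hU : ∀ g, ∀ w ∈ U, η.op g w ∈ U) :
    ProjRep α (V ⧸ U) :=
  ofEnd α (fun g => U.mapQ U (η.op g) (hU g))
    (by ext v; simp [η.op_one])
    (fun g h => by ext v; simp [η.op_op])

/-- The tensor product of an `α`-representation and a `β`-representation. -/
noncomputable def tensor (η : ProjRep α V) (θ : ProjRep β W) : ProjRep (α + β) (V ⊗[F] W) :=
  ofEnd (α + β) (fun g => TensorProduct.map (η.op g) (θ.op g))
    (by
      ext v w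
      simp [η.op_one, θ.op_one, Cocycle.val_add, ← TensorProduct.smul_tmul', smul_smul, mul_comm])
    (fun g h => by
      ext v w
      simp [η.op_op, θ.op_op, Cocycle.val_add, ← TensorProduct.smul_tmul', smul_smul, mul_comm])

/-- The `k`-th exterior power of an `α`-representation, an `α ^ k`-representation. -/
noncomputable def extPower (η : ProjRep α V) (k : ℕ) : ProjRep (k • α) (⋀[F]^k V) :=
  ofEnd (k • α) (fun g => exteriorPower.map k (η.op g))
    (by
      ext v
      simp [η.op_one, Cocycle.val_nsmul, AlternatingMap.map_smul_univ])
    (fun g h => by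
      ext v
      simp [η.op_op, Cocycle.val_nsmul, exteriorPower.map_apply_ιMulti, Function.comp_def,
        AlternatingMap.map_smul_univ])

/-- The left regular representation on the twisted group algebra. -/
noncomputable def regular (α : Cocycle F G) : ProjRep α (TwistedGroupAlgebra α) :=
  ofEnd α (fun g => LinearMap.mulLeft F (TwistedGroupAlgebra.u α g))
    (by
      ext v
      simp [TwistedGroupAlgebra.u_one])
    (fun g h => by
      ext v
      simp [← mul_assoc, TwistedGroupAlgebra.u_mul_u])

end ProjRep

/-! ### Divisibility of dimensions -/

section Dimensions

variable {F : Type} [Field F] {G : Type} [Group G] {α β : Cocycle F G}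

/-- The greatest common divisor of the dimensions of the irreducible `α`-representations divides
the dimension of every `α`-representation. -/
theorem dimGcd_dvd_finrank {V : Type} [AddCommGroup V] [Module F V] [FiniteDimensional F V]
    (η : ProjRep α V) : dimGcd α ∣ finrank F V := by
  induction hd : finrank F V using Nat.strong_induction_on generalizing V with
  | _ d ih =>
    rcases subsingleton_or_nontrivial V with hV | hV
    · rw [← hd, finrank_zero_of_subsingleton]; exact dvd_zero _
    · by_cases hirr : η.IsIrreducible
      · exact (dvd_setGcd_iff _ _).1 dvd_rfl d ⟨V, _, _, ‹_›, η, hirr, hd⟩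
      -- Dimension is additive along an invariant subspace and its quotient, so complete
      -- reducibility is not needed.
      · have : ∃ U : Submodule F V, (∀ g, ∀ w ∈ U, η.op g w ∈ U) ∧ U ≠ ⊥ ∧ U ≠ ⊤ := by
          by_contra! hcon
          refine hirr ⟨hV, fun U hU => ?_⟩
          by_cases hb : U = ⊥
          · exact Or.inl hb
          · exact Or.inr (hcon U hU hb)
        obtain ⟨U, hU, hbot, htop⟩ := this
        have hsum := Submodule.finrank_quotient_add_finrank U
        have hpos : 0 < finrank F U := by
          rw [Nat.pos_iff_ne_zero]
          exact fun h => hbot (Submodule.finrank_eq_zero.1 h)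
        have hlt : finrank F U < finrank F V := Submodule.finrank_lt htop
        rw [← hd, ← hsum]
        exact dvd_add (ih _ (by omega) (η.quot U hU) rfl) (ih _ (by omega) (η.sub U hU) rfl)

/-- The regular representation has nonzero dimension `|G|`, which excludes the degenerate value `0`.
-/
theorem dimGcd_pos [Finite G] (α : Cocycle F G) : 0 < dimGcd α := by
  have : FiniteDimensional F (TwistedGroupAlgebra α) :=
    (TwistedGroupAlgebra.u α).finiteDimensional_of_finite
  have h := dimGcd_dvd_finrank (ProjRep.regular α)
  rw [Module.finrank_eq_nat_card_basis (TwistedGroupAlgebra.u α)] at h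
  exact Nat.pos_of_dvd_of_pos h Nat.card_pos

/-- The order of the class of `α` divides the dimension of every `α`-representation. -/
theorem addOrderOf_cls_dvd_finrank {V : Type} [AddCommGroup V] [Module F V]
    [FiniteDimensional F V] (η : ProjRep α V) : addOrderOf α.cls ∣ finrank F V := by
  rw [addOrderOf_dvd_iff_nsmul_eq_zero, ← Cocycle.cls_nsmul, Cocycle.cls_eq_zero_iff]
  -- Taking determinants in the defining relation exhibits `α ^ dim V` as the coboundary of `det ∘
  -- η`.
  refine ⟨fun g => Units.map LinearMap.det (η.toFun g), fun g h => Units.ext ?_⟩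
  have := congrArg LinearMap.det (η.op_mul g h)
  rw [_root_.map_mul, LinearMap.det_smul] at this
  exact this

/-- The representation used is `Λ^i V ⊗ (Λ^k V)^{⊗t}`. -/
theorem dimGcd_dvd_choose {V : Type} [AddCommGroup V] [Module F V]
    [FiniteDimensional F V] (η : ProjRep α V) (i k t : ℕ) :
    dimGcd ((i + k * t) • α) ∣
      (finrank F V).choose i * ((finrank F V).choose k) ^ t := by
  suffices ∃ (W : Type) (_ : AddCommGroup W) (_ : Module F W) (_ : FiniteDimensional F W)
      (_ : ProjRep ((i + k * t) • α) W),
      finrank F W = (finrank F V).choose i * ((finrank F V).choose k) ^ t by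
    obtain ⟨W, _, _, _, θ, hW⟩ := this
    rw [← hW]
    exact dimGcd_dvd_finrank θ
  induction t with
  | zero =>
    refine ⟨⋀[F]^i V, inferInstance, inferInstance, inferInstance, ?_, ?_⟩
    · simpa using η.extPower i
    · simp [exteriorPower.finrank_eq]
  | succ t ih =>
    obtain ⟨W, _, _, _, θ, hW⟩ := ih
    refine ⟨W ⊗[F] (⋀[F]^k V), inferInstance, inferInstance, inferInstance, ?_, ?_⟩
    · have := θ.tensor (η.extPower k)
      rwa [← add_smul, add_assoc, ← Nat.mul_succ] at this
    · rw [Module.finrank_tensorProduct, hW, exteriorPower.finrank_eq, pow_succ, mul_assoc]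

end Dimensions

/-! ### Valuations of binomial coefficients -/

section Binomials

/-- For `k ≤ a`, `q^k` divides `d`, so it divides `d - l` iff it divides `l`; for `k ≥ a` it divides
neither. -/
theorem factorization_sub_of_lt_prime_pow {q a d l : ℕ} (hq : q.Prime)
    (hd : q ^ a ∣ d) (hl0 : l ≠ 0) (hl : l < q ^ a) (hld : l < d) :
    (d - l).factorization q = l.factorization q := by
  have key : ∀ k, q ^ k ∣ d - l ↔ q ^ k ∣ l := by
    intro k
    rcases le_total k a with hk | hk
    · have hkd := (pow_dvd_pow q hk).trans hd
      exact (Nat.dvd_sub_iff_right hld.le hkd)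
    · constructor <;> intro h
      · have h1 : q ^ a ∣ l := (Nat.dvd_sub_iff_right hld.le hd).1 ((pow_dvd_pow q hk).trans h)
        exact absurd (Nat.le_of_dvd (Nat.pos_of_ne_zero hl0) h1) (not_le.2 hl)
      · exact absurd (Nat.le_of_dvd (Nat.pos_of_ne_zero hl0) ((pow_dvd_pow q hk).trans h))
          (not_le.2 hl)
  have hne : d - l ≠ 0 := by omega
  apply le_antisymm
  · exact (hq.pow_dvd_iff_le_factorization hl0).1
      ((key _).1 ((hq.pow_dvd_iff_le_factorization hne).2 le_rfl))
  · exact (hq.pow_dvd_iff_le_factorization hne).1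
      ((key _).2 ((hq.pow_dvd_iff_le_factorization hl0).2 le_rfl))

/-- `C(d-1,j)` is the product of `(d-l)/l` over `1 ≤ l ≤ j`, and every factor has valuation `0`. -/
theorem factorization_choose_pred {q a d : ℕ} (hq : q.Prime) (hd0 : d ≠ 0)
    (hd : q ^ a ∣ d) {j : ℕ} (hj : j < q ^ a) :
    ((d - 1).choose j).factorization q = 0 := by
  have had := Nat.le_of_dvd (Nat.pos_of_ne_zero hd0) hd
  induction j with
  | zero => simp
  | succ j ih =>
    have h := Nat.choose_succ_right_eq (d - 1) j
    have h1 : (d - 1).choose j ≠ 0 := (Nat.choose_pos (by omega)).ne'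
    have h2 : (d - 1).choose (j + 1) ≠ 0 := (Nat.choose_pos (by omega)).ne'
    have h3 := congrArg (fun n => n.factorization q) h
    simp only [Nat.factorization_mul h2 (Nat.succ_ne_zero j),
      Nat.factorization_mul h1 (show d - 1 - j ≠ 0 by omega), Finsupp.add_apply] at h3
    rw [ih (by omega), show d - 1 - j = d - (j + 1) by omega,
      factorization_sub_of_lt_prime_pow hq hd (Nat.succ_ne_zero j) hj (by omega)] at h3
    omega

/-- Follows from `i C(d,i) = d C(d-1,i-1)`, whose last factor is prime to `q`. -/
theorem factorization_choose_add {q a d i : ℕ} (hq : q.Prime) (hd0 : d ≠ 0)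
    (hd : q ^ a ∣ d) (hi0 : i ≠ 0) (hi : i ≤ q ^ a) :
    (d.choose i).factorization q + i.factorization q = d.factorization q := by
  have had := Nat.le_of_dvd (Nat.pos_of_ne_zero hd0) hd
  obtain ⟨e, rfl⟩ := Nat.exists_eq_succ_of_ne_zero hd0
  obtain ⟨j, rfl⟩ := Nat.exists_eq_succ_of_ne_zero hi0
  have h := Nat.add_one_mul_choose_eq e j
  have h1 : e.choose j ≠ 0 := (Nat.choose_pos (by omega)).ne'
  have h2 : (e + 1).choose (j + 1) ≠ 0 := (Nat.choose_pos (by omega)).ne'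
  have h3 := congrArg (fun n => n.factorization q) h
  have h4 := factorization_choose_pred hq hd0 hd (j := j) (by omega)
  simp only [Nat.factorization_mul h2 (Nat.succ_ne_zero j),
    Nat.factorization_mul (Nat.succ_ne_zero e) h1, Finsupp.add_apply] at h3
  simp only [Nat.succ_eq_add_one, Nat.add_sub_cancel] at h3 h4 ⊢
  omega

end Binomials

/-! ### The drop of the gcd -/

section

variable {F : Type} [Field F] {G : Type} [Group G] [Finite G] (α : Cocycle F G)

/-- Otherwise one more power of `q` would divide every dimension, hence the gcd. -/
theorem exists_mem_irrDims_factorization_eq {q : ℕ} (hq : q.Prime) :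
    ∃ d ∈ irrDims α, d ≠ 0 ∧ d.factorization q = (dimGcd α).factorization q := by
  have hc0 := (dimGcd_pos α).ne'
  by_contra! hcon
  have hdvd : q ^ ((dimGcd α).factorization q + 1) ∣ dimGcd α := by
    refine (dvd_setGcd_iff _ _).2 fun d hd => ?_
    by_cases hd0 : d = 0
    · exact hd0 ▸ dvd_zero _
    · have h1 : dimGcd α ∣ d := (dvd_setGcd_iff _ _).1 dvd_rfl d hd
      have h2 : (dimGcd α).factorization q ≤ d.factorization q :=
        (Nat.factorization_le_iff_dvd hc0 hd0).2 h1 q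
      exact (hq.pow_dvd_iff_le_factorization hd0).2
        (lt_of_le_of_ne h2 (hcon d hd hd0).symm)
  have := (hq.pow_dvd_iff_le_factorization hc0).1 hdvd
  omega

/-- The `q`-part of `c_{G,α^r}` is at most that of `c_{G,α}`, and is smaller if `q` divides both
`r` and the order of `[α]`. -/
theorem factorization_dimGcd_nsmul {q : ℕ} (hq : q.Prime) (r : ℕ) :
    (dimGcd (r • α)).factorization q ≤ (dimGcd α).factorization q ∧
      (q ∣ r → q ∣ addOrderOf α.cls →
        (dimGcd (r • α)).factorization q < (dimGcd α).factorization q) := by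
  obtain ⟨d, ⟨V, _, _, _, η, -, hd⟩, hd0, hda⟩ := exists_mem_irrDims_factorization_eq α hq
  rw [← hda]
  set a := d.factorization q with ha
  have hpow : q ^ a ∣ d := (hq.pow_dvd_iff_le_factorization hd0).2 le_rfl
  have hqa : q ^ a ≤ d := Nat.le_of_dvd (Nat.pos_of_ne_zero hd0) hpow
  have hapos : q ∣ addOrderOf α.cls → 0 < a := fun h =>
    hq.factorization_pos_of_dvd hd0 (hd ▸ h.trans (addOrderOf_cls_dvd_finrank η))
  have hqpos : 0 < q ^ a := pow_pos hq.pos a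
  have key : ∀ i t, i ≤ q ^ a → (dimGcd ((i + q ^ a * t) • α)).factorization q ≤
      (d.choose i).factorization q := by
    intro i t hi
    have h := dimGcd_dvd_choose η i (q ^ a) t
    rw [hd] at h
    have h1 : d.choose i ≠ 0 := (Nat.choose_pos (by omega)).ne'
    have h2 : d.choose (q ^ a) ≠ 0 := (Nat.choose_pos hqa).ne'
    refine ((Nat.factorization_le_iff_dvd (dimGcd_pos _).ne'
      (mul_ne_zero h1 (pow_ne_zero t h2))).2 h q).trans ?_
    -- At `i = q^a` the valuation of the binomial is `a - a = 0`, so the `t` extra tensor factors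
    -- contribute nothing.
    have h3 := factorization_choose_add hq hd0 hpow hqpos.ne' le_rfl
    rw [← ha, hq.factorization_pow, Finsupp.single_eq_same] at h3
    rw [Nat.factorization_mul h1 (pow_ne_zero t h2), Nat.factorization_pow, Finsupp.add_apply,
      Finsupp.smul_apply, show (d.choose (q ^ a)).factorization q = 0 by omega]
    simp
  rcases Nat.eq_zero_or_pos r with rfl | hr
  · have h := key 0 0 (Nat.zero_le _)
    simp only [Nat.choose_zero_right, Nat.factorization_one, Finsupp.coe_zero, Pi.zero_apply,
      mul_zero, add_zero] at h
    exact ⟨h.trans (Nat.zero_le _), fun _ hn => lt_of_le_of_lt h (hapos hn)⟩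
  -- The representative of `r` modulo `q^a` in `[1, q^a]` rather than `[0, q^a)`, as the valuation
  -- formula needs `i ≠ 0`.
  · set i := (r - 1) % q ^ a + 1 with hi
    have hi0 : i ≠ 0 := Nat.succ_ne_zero _
    have hile : i ≤ q ^ a := Nat.mod_lt _ hqpos
    have hr' : i + q ^ a * ((r - 1) / q ^ a) = r := by
      have := Nat.mod_add_div (r - 1) (q ^ a)
      omega
    have h := key i ((r - 1) / q ^ a) hile
    rw [hr'] at h
    have h3 := factorization_choose_add hq hd0 hpow hi0 hile
    rw [← ha] at h3
    refine ⟨by omega, fun hqr hn => ?_⟩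
    have hqi : q ∣ i := by
      have h4 : q ∣ q ^ a * ((r - 1) / q ^ a) :=
        Dvd.dvd.mul_right (dvd_pow_self q (hapos hn).ne') _
      exact (Nat.dvd_add_left h4).1 (by rwa [hr'])
    have := hq.factorization_pos_of_dvd hi0 hqi
    omega

theorem dimGcd_nsmul_lt (r : ℕ) (hr : Nat.gcd r (addOrderOf α.cls) ≠ 1) :
    dimGcd (r • α) < dimGcd α := by
  obtain ⟨p, hp, hpr⟩ := Nat.exists_prime_and_dvd hr
  have h1 := (dimGcd_pos (r • α)).ne'
  have h2 := (dimGcd_pos α).ne'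
  have hdvd : dimGcd (r • α) ∣ dimGcd α := by
    rw [← Nat.factorization_prime_le_iff_dvd h1 h2]
    exact fun q hq => (factorization_dimGcd_nsmul α hq r).1
  refine lt_of_le_of_ne (Nat.le_of_dvd (dimGcd_pos α) hdvd) fun heq => ?_
  have h := (factorization_dimGcd_nsmul α hp r).2 (hpr.trans (Nat.gcd_dvd_left _ _))
    (hpr.trans (Nat.gcd_dvd_right _ _))
  rw [heq] at h
  exact lt_irrefl _ h

end

/-! ### Maschke's theorem and isomorphisms of twisted group algebras -/

namespace TwistedGroupAlgebra

variable {F : Type} [Field F] {G : Type} [Group G] (α β : Cocycle F G)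

theorem isUnit_u (g : G) : IsUnit (u α g) := by
  have h : ∀ x : Fˣ, IsUnit ((x : F) • (1 : TwistedGroupAlgebra α)) := fun x => by
    rw [← Algebra.algebraMap_eq_smul_one]
    exact x.isUnit.map _
  have h1 : ∀ g : G, IsUnit (u α g * u α g⁻¹) := fun g => by
    rw [u_mul_u, mul_inv_cancel, u_one, smul_smul, ← Units.val_mul]
    exact h _
  have h2 : IsUnit (u α g⁻¹ * u α g) := by simpa using h1 g⁻¹
  obtain ⟨x, hx⟩ := h1 g
  obtain ⟨y, hy⟩ := h2
  refine isUnit_iff_exists_and_exists.2 ⟨⟨u α g⁻¹ * ↑x⁻¹, ?_⟩, ⟨↑y⁻¹ * u α g⁻¹, ?_⟩⟩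
  · rw [← mul_assoc, ← hx, Units.mul_inv]
  · rw [mul_assoc, ← hy, Units.inv_mul]

/-- Maschke's theorem for twisted group algebras. -/
theorem isSemisimpleRing [Finite G] [CharZero F] : IsSemisimpleRing (TwistedGroupAlgebra α) := by
  have := Fintype.ofFinite G
  refine { exists_isCompl := fun p => ?_ }
  obtain ⟨φ, hφ⟩ := (p.subtype.restrictScalars F).exists_leftInverse_of_injective
    (LinearMap.ker_eq_bot.2 p.injective_subtype)
  choose U hU using isUnit_u α
  let f : G → TwistedGroupAlgebra α →ₗ[F] p := fun g =>
    (Algebra.lsmul F F p (↑(U g)⁻¹ : TwistedGroupAlgebra α)) ∘ₗ φ ∘ₗ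
      LinearMap.mulLeft F (u α g)
  have hf : ∀ g v, f g v = (↑(U g)⁻¹ : TwistedGroupAlgebra α) • φ (u α g * v) := fun _ _ => rfl
  -- The average of the conjugates `u_g⁻¹ φ(u_g ·)` of a linear projection; the scalars of `α`
  -- cancel in each conjugate.
  let ψ : TwistedGroupAlgebra α →ₗ[F] p := (Fintype.card G : F)⁻¹ • ∑ g, f g
  have hψ : ∀ v, ψ v = (Fintype.card G : F)⁻¹ • ∑ g, f g v := fun v => by simp [ψ]
  have hfu : ∀ g h v, f g (u α h * v) = u α h • f (g * h) v := fun g h v => by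
    have e : (↑(U g)⁻¹ : TwistedGroupAlgebra α) * ((α.val g h : F) • 1) =
        u α h * ↑(U (g * h))⁻¹ := by
      rw [← Units.mul_right_inj (U g), ← Units.mul_left_inj (U (g * h)), ← mul_assoc,
        Units.mul_inv, one_mul, mul_assoc, mul_assoc, Units.inv_mul, mul_one, hU, hU, u_mul_u,
        smul_mul_assoc, one_mul]
    rw [hf, hf, ← mul_assoc, u_mul_u, smul_mul_assoc, map_smul, smul_smul, ← e, mul_smul,
      smul_assoc, one_smul]
  have hψu : ∀ h v, ψ (u α h * v) = u α h • ψ v := fun h v => by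
    rw [hψ, hψ, smul_comm (u α h)]
    refine congrArg _ ?_
    rw [Finset.smul_sum]
    exact Fintype.sum_bijective (· * h) (Group.mulRight_bijective h)
      (fun g => f g (u α h * v)) (fun g => u α h • f g v) fun g => hfu g h v
  have hψA : ∀ a v, ψ (a * v) = a • ψ v := fun a v => by
    have : ψ ∘ₗ LinearMap.mulRight F v =
        (LinearMap.toSpanSingleton (TwistedGroupAlgebra α) p (ψ v)).restrictScalars F :=
      (u α).ext fun h => hψu h v
    exact LinearMap.congr_fun this a
  let Ψ : TwistedGroupAlgebra α →ₗ[TwistedGroupAlgebra α] p :=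
    { toFun := ψ, map_add' := map_add ψ, map_smul' := hψA }
  refine ⟨LinearMap.ker Ψ, LinearMap.isCompl_of_proj fun x => ?_⟩
  change ψ x = x
  have hx : ∀ g, f g x = x := fun g => by
    have h1 : φ (u α g * x) = u α g • x := LinearMap.congr_fun hφ (u α g • x)
    rw [hf, h1, smul_smul, ← hU, Units.inv_mul, one_smul]
  rw [hψ]
  simp only [hx, Finset.sum_const, Finset.card_univ]
  rw [← Nat.cast_smul_eq_nsmul F, smul_smul,
    inv_mul_cancel₀ (Nat.cast_ne_zero.2 Fintype.card_ne_zero), one_smul]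

variable {α β}

/-- Cohomologous cocycles have isomorphic twisted group algebras. -/
theorem nonempty_algEquiv_of_coboundary (f : G → Fˣ)
    (hf : ∀ g h, f g * f h * β.val g h = α.val g h * f (g * h)) :
    Nonempty (TwistedGroupAlgebra α ≃ₐ[F] TwistedGroupAlgebra β) := by
  let e := (u α).equiv ((u β).unitsSMul f) (Equiv.refl G)
  have he : ∀ g, e (u α g) = (f g : F) • u β g := fun g => by
    simp [e, Basis.unitsSMul_apply, Units.smul_def]
  have hmul : ∀ x y, e (x * y) = e x * e y := by
    have : (LinearMap.mul F (TwistedGroupAlgebra α)).compr₂ e.toLinearMap =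
        (LinearMap.mul F (TwistedGroupAlgebra β)).compl₁₂ e.toLinearMap e.toLinearMap := by
      refine (u α).ext fun g => (u α).ext fun h => ?_
      have h1 := congrArg Units.val (hf g h)
      simp only [Units.val_mul] at h1
      simp [he, u_mul_u, smul_smul, ← h1, mul_left_comm, mul_assoc]
    exact fun x y => LinearMap.congr_fun (LinearMap.congr_fun this x) y
  refine ⟨AlgEquiv.ofLinearEquiv e ?_ hmul⟩
  have h1 := hmul 1 (e.symm 1)
  rw [one_mul, LinearEquiv.apply_symm_apply, mul_one] at h1
  exact h1.symm

/-- A field automorphism which maps the values of `α` to those of `β` induces a ring isomorphism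
of the twisted group algebras. -/
theorem exists_ringEquiv_of_fieldAut (σ : F ≃+* F)
    (hσ : ∀ g h, σ (α.val g h) = β.val g h) :
    ∃ S : TwistedGroupAlgebra α ≃+* TwistedGroupAlgebra β,
      ∀ c, S (algebraMap F _ c) = algebraMap F _ (σ c) := by
  let S : TwistedGroupAlgebra α ≃+ TwistedGroupAlgebra β :=
    Finsupp.mapRange.addEquiv (ι := G) σ.toAddEquiv
  have hsmul : ∀ (c : F) x, S (c • x) = σ c • S x := fun c x => by
    refine Finsupp.ext fun g => ?_
    exact σ.map_mul c (DFunLike.coe (F := G →₀ F) x g)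
  have hu : ∀ g, S (u α g) = u β g := fun g => by
    change Finsupp.mapRange σ (map_zero σ) (Finsupp.single g (1 : F)) = Finsupp.single g (1 : F)
    simp
  have hmulu : ∀ g h, S (u α g * u α h) = S (u α g) * S (u α h) := fun g h => by
    rw [u_mul_u, hsmul, hu, hu, hu, u_mul_u, hσ]
  have hmulu' : ∀ g y, S (u α g * y) = S (u α g) * S y := fun g y => by
    induction (u α).mem_span y using Submodule.span_induction with
    | mem y hy => obtain ⟨h, rfl⟩ := hy; exact hmulu g h
    | zero => simp
    | add y z _ _ hy hz => rw [mul_add, map_add, map_add, mul_add, hy, hz]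
    | smul c y _ hy => rw [mul_smul_comm, hsmul, hsmul, hy, mul_smul_comm]
  have hmul : ∀ x y, S (x * y) = S x * S y := fun x y => by
    induction (u α).mem_span x using Submodule.span_induction with
    | mem x hx => obtain ⟨g, rfl⟩ := hx; exact hmulu' g y
    | zero => simp
    | add x z _ _ hx hz => rw [add_mul, map_add, map_add, add_mul, hx, hz]
    | smul c x _ hx => rw [smul_mul_assoc, hsmul, hsmul, hx, smul_mul_assoc]
  let S' : TwistedGroupAlgebra α ≃+* TwistedGroupAlgebra β :=
    { S with map_mul' := hmul }
  refine ⟨S', fun c => ?_⟩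
  have h1 : S 1 = 1 := map_one S'
  rw [Algebra.algebraMap_eq_smul_one, Algebra.algebraMap_eq_smul_one, ← h1]
  exact hsmul c 1

end TwistedGroupAlgebra

/-! ### Field automorphisms and the coprime case -/

/-- A ring isomorphism between semisimple algebras over an algebraically closed field which is
semilinear for a field automorphism can be replaced by an algebra isomorphism. -/
theorem nonempty_algEquiv_of_semilinear {F A B : Type*} [Field F] [IsAlgClosed F] [Ring A]
    [Algebra F A] [Ring B] [Algebra F B] [IsSemisimpleRing A] [FiniteDimensional F A]
    (σ : F ≃+* F) (S : A ≃+* B) (hS : ∀ c, S (algebraMap F A c) = algebraMap F B (σ c)) :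
    Nonempty (A ≃ₐ[F] B) := by
  obtain ⟨n, d, -, ⟨e⟩⟩ := IsSemisimpleRing.exists_algEquiv_pi_matrix_of_isAlgClosed F A
  -- Entrywise `σ⁻¹`, to cancel the semilinearity of `S`.
  let T : (Π i, Matrix (Fin (d i)) (Fin (d i)) F) ≃+* (Π i, Matrix (Fin (d i)) (Fin (d i)) F) :=
    RingEquiv.piCongrRight fun i => σ.symm.mapMatrix
  have hT : ∀ c, T (algebraMap F _ c) = algebraMap F _ (σ.symm c) := fun c => by
    ext i j k
    simp [T, Matrix.algebraMap_matrix_apply, apply_ite σ.symm]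
  refine ⟨AlgEquiv.ofRingEquiv
    (f := (e.toRingEquiv.trans T).trans (e.symm.toRingEquiv.trans S)) fun c => ?_⟩
  have h1 : e (algebraMap F A c) = algebraMap F _ c := e.commutes c
  have h2 : e.symm (algebraMap F _ (σ.symm c)) = algebraMap F A (σ.symm c) := e.symm.commutes _
  change S (e.symm (T (e (algebraMap F A c)))) = _
  rw [h1, hT, h2, hS, RingEquiv.apply_symm_apply]

/-- An automorphism of a field extends to every algebraically closed extension. -/
theorem exists_ringEquiv_extends {K L : Type*} [Field K] [Field L] [Algebra K L] [IsAlgClosed L]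
    (τ : K ≃+* K) : ∃ σ : L ≃+* L, ∀ x, σ (algebraMap K L x) = algebraMap K L (τ x) := by
  -- `τ` acts on the coefficients of the polynomial ring on a transcendence basis, and `L` is an
  -- algebraic closure over that ring.
  obtain ⟨s, hs⟩ := exists_isTranscendenceBasis K L
  have := IsAlgClosed.isAlgClosure_of_transcendence_basis _ hs
  let ε := hs.1.aevalEquiv
  let τ' := (ε.symm.toRingEquiv.trans (MvPolynomial.mapEquiv s τ)).trans ε.toRingEquiv
  refine ⟨IsAlgClosure.equivOfEquiv L L τ', fun x => ?_⟩
  have h := IsAlgClosure.equivOfEquiv_algebraMap L L τ' (algebraMap K _ x)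
  rw [← IsScalarTower.algebraMap_apply] at h
  rw [h, IsScalarTower.algebraMap_apply K (Algebra.adjoin K (Set.range ((↑) : s → L))) L (τ x)]
  congr 1
  change ε (MvPolynomial.map (τ : K →+* K) (ε.symm (algebraMap K _ x))) = _
  rw [AlgEquiv.commutes, MvPolynomial.algebraMap_eq, MvPolynomial.map_C]
  exact ε.commutes (τ x)

/-- For `r` coprime to `n`, some automorphism acts on the `n`-th roots of unity as `x ↦ x ^ r`. -/
theorem exists_ringEquiv_pow (L : Type*) [Field L] [CharZero L] [IsAlgClosed L] {n r : ℕ}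
    (hn : n ≠ 0) (hr : Nat.Coprime r n) :
    ∃ σ : L ≃+* L, ∀ x, x ^ n = 1 → σ x = x ^ r := by
  have : NeZero n := ⟨hn⟩
  have : NeZero ((n : ℕ) : ℚ) := ⟨Nat.cast_ne_zero.2 hn⟩
  obtain ⟨K, _, _, _⟩ : ∃ (K : Type) (_ : Field K) (_ : Algebra ℚ K),
      IsCyclotomicExtension {n} ℚ K :=
    ⟨CyclotomicField n ℚ, _, _, CyclotomicField.isCyclotomicExtension n ℚ⟩
  have := IsCyclotomicExtension.finiteDimensional {n} ℚ K
  let _ : Algebra K L := (IsAlgClosed.lift (R := ℚ) (S := K) (M := L)).toAlgebra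
  have hζ := IsCyclotomicExtension.zeta_spec n ℚ K
  set ζ := IsCyclotomicExtension.zeta n ℚ K
  have hμ : IsPrimitiveRoot (ζ ^ r) n := hζ.pow_of_coprime r hr
  let τ := IsCyclotomicExtension.fromZetaAut hμ
    (Polynomial.cyclotomic.irreducible_rat (NeZero.pos n))
  have hτ : τ ζ = ζ ^ r := IsCyclotomicExtension.fromZetaAut_spec hμ _
  obtain ⟨σ, hσ⟩ := exists_ringEquiv_extends (L := L) τ.toRingEquiv
  refine ⟨σ, fun x hx => ?_⟩
  have hζL : IsPrimitiveRoot (algebraMap K L ζ) n :=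
    hζ.map_of_injective (algebraMap K L).injective
  obtain ⟨i, -, rfl⟩ := hζL.eq_pow_of_pow_eq_one hx
  have : σ (algebraMap K L ζ) = algebraMap K L ζ ^ r := by
    rw [hσ, ← map_pow, ← hτ]; rfl
  rw [map_pow, this, ← pow_mul, ← pow_mul, mul_comm]

/-- If `r` is coprime to the order of `[α]`, then the twisted group algebras of `α` and `α ^ r`
are isomorphic. -/
theorem nonempty_algEquiv_nsmul {F : Type} [Field F] [IsAlgClosed F] [CharZero F] {G : Type}
    [Group G] [Finite G] (α : Cocycle F G) {r : ℕ} (hr : Nat.Coprime r (addOrderOf α.cls)) :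
    Nonempty (TwistedGroupAlgebra α ≃ₐ[F] TwistedGroupAlgebra (r • α)) := by
  set n := addOrderOf α.cls with hn
  -- Infinite order is recorded as `0`; coprimality then forces `r = 1`.
  by_cases hn0 : n = 0
  · rw [hn0, Nat.coprime_zero_right] at hr
    rw [hr, one_smul]
    exact ⟨AlgEquiv.refl⟩
  have hcls : (n • α).cls = 0 := by rw [Cocycle.cls_nsmul, hn, addOrderOf_nsmul_eq_zero]
  obtain ⟨f, hf⟩ := (Cocycle.cls_eq_zero_iff _).1 hcls
  -- Since `α ^ n` is the coboundary of `f`, dividing `α` by the coboundary of an `n`-th root `c` of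
  -- `f` leaves `n`-th roots of unity.
  have hroot : ∀ g, ∃ c : Fˣ, c ^ n = f g := fun g => by
    obtain ⟨z, hz⟩ := IsAlgClosed.exists_pow_nat_eq (f g : F) (Nat.pos_of_ne_zero hn0)
    have hz0 : z ≠ 0 := by
      rintro rfl
      rw [zero_pow hn0] at hz
      exact (f g).ne_zero hz.symm
    exact ⟨Units.mk0 z hz0, Units.ext hz⟩
  choose c hc using hroot
  let β : Cocycle F G := α - Cocycle.coboundary c
  have hβ : ∀ g h, β.val g h = α.val g h / (c g * c h / c (g * h)) := fun _ _ => rfl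
  have hβn : ∀ g h, β.val g h ^ n = 1 := fun g h => by
    rw [hβ, div_pow, div_pow, mul_pow, hc, hc, hc, hf, Cocycle.val_nsmul, mul_div_cancel_right,
      div_self']
  have hαβ : ∀ g h, c g * c h * β.val g h = α.val g h * c (g * h) := fun g h => by
    rw [hβ, div_div_eq_mul_div, mul_div_cancel]
  obtain ⟨e₁⟩ := TwistedGroupAlgebra.nonempty_algEquiv_of_coboundary (α := α) (β := β) c hαβ
  obtain ⟨e₂⟩ := TwistedGroupAlgebra.nonempty_algEquiv_of_coboundary (α := r • α) (β := r • β)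
    (fun g => c g ^ r) fun g h => by
      rw [Cocycle.val_nsmul, Cocycle.val_nsmul, ← mul_pow, ← mul_pow, hαβ, mul_pow]
  obtain ⟨σ, hσ⟩ := exists_ringEquiv_pow F hn0 hr
  obtain ⟨S, hS⟩ := TwistedGroupAlgebra.exists_ringEquiv_of_fieldAut (α := β) (β := r • β) σ
    fun g h => by
      rw [hσ _ (by rw [← Units.val_pow_eq_pow_val, hβn, Units.val_one]), Cocycle.val_nsmul,
        Units.val_pow_eq_pow_val]
  have := TwistedGroupAlgebra.isSemisimpleRing β
  have : FiniteDimensional F (TwistedGroupAlgebra β) :=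
    (TwistedGroupAlgebra.u β).finiteDimensional_of_finite
  obtain ⟨e⟩ := nonempty_algEquiv_of_semilinear σ S hS
  exact ⟨(e₁.trans e).trans e₂.symm⟩

/-! ### Ring invariance of the irreducible dimensions -/

section Irreducible

variable {F : Type} [Field F] {G : Type} [Group G] {α β : Cocycle F G}

/-- The action of the twisted group algebra on an `α`-representation. -/
noncomputable def ProjRep.toAlgHom {V : Type*} [AddCommGroup V] [Module F V] (η : ProjRep α V) :
    TwistedGroupAlgebra α →ₐ[F] Module.End F V :=
  have hu : ∀ g, (TwistedGroupAlgebra.u α).constr F η.op (TwistedGroupAlgebra.u α g) = η.op g :=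
    fun g => Basis.constr_basis _ _ _ g
  AlgHom.ofLinearMap ((TwistedGroupAlgebra.u α).constr F η.op)
    (by rw [TwistedGroupAlgebra.one_def, map_smul, hu, η.op_one, smul_smul, Units.inv_mul,
      one_smul]; rfl)
    (by
      have : (LinearMap.mul F (TwistedGroupAlgebra α)).compr₂
            ((TwistedGroupAlgebra.u α).constr F η.op) =
          (LinearMap.mul F (Module.End F V)).compl₁₂
            ((TwistedGroupAlgebra.u α).constr F η.op)
            ((TwistedGroupAlgebra.u α).constr F η.op) := by
        refine (TwistedGroupAlgebra.u α).ext fun g => (TwistedGroupAlgebra.u α).ext fun h => ?_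
        simp only [LinearMap.compr₂_apply, LinearMap.compl₁₂_apply, LinearMap.mul_apply',
          TwistedGroupAlgebra.u_mul_u, map_smul, hu, η.op_mul]
      exact fun x y => LinearMap.congr_fun (LinearMap.congr_fun this x) y)

theorem ProjRep.toAlgHom_u {V : Type*} [AddCommGroup V] [Module F V] (η : ProjRep α V) (g : G) :
    η.toAlgHom (TwistedGroupAlgebra.u α g) = η.op g :=
  Basis.constr_basis (TwistedGroupAlgebra.u α) F η.op g

/-- Schur's lemma: the endomorphism ring is `k`. -/
theorem finrank_end_eq {k A V : Type*} [Field k] [IsAlgClosed k] [Ring A] [Algebra k A]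
    [AddCommGroup V] [Module k V] [Module A V] [IsScalarTower k A V] [FiniteDimensional k V]
    [IsSimpleModule A V] : finrank (Module.End A V) V = finrank k V :=
  (congrArg Cardinal.toNat (rank_eq_of_equiv_equiv (algebraMap k (Module.End A V))
    (AddEquiv.refl V) (IsSimpleModule.algebraMap_end_bijective_of_isAlgClosed k)
    fun _ _ => rfl)).symm

/-- The right side makes no use of the `F`-structure, so it passes through ring isomorphisms that
are not `F`-linear. -/
theorem mem_irrDims_iff [IsAlgClosed F] [Finite G] (d : ℕ) :
    d ∈ irrDims α ↔ ∃ (V : Type) (_ : AddCommGroup V) (_ : Module (TwistedGroupAlgebra α) V),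
      IsSimpleModule (TwistedGroupAlgebra α) V ∧
        finrank (Module.End (TwistedGroupAlgebra α) V) V = d := by
  constructor
  · rintro ⟨V, _, _, _, η, ⟨hV, hirr⟩, rfl⟩
    let _ : Module (TwistedGroupAlgebra α) V := Module.compHom V η.toAlgHom.toRingHom
    have hsmul : ∀ (a : TwistedGroupAlgebra α) (v : V), a • v = η.toAlgHom a v := fun _ _ => rfl
    have : IsScalarTower F (TwistedGroupAlgebra α) V :=
      ⟨fun c a v => by rw [hsmul, hsmul, map_smul]; rfl⟩
    have hs : IsSimpleModule (TwistedGroupAlgebra α) V := by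
      refine { exists_pair_ne := ⟨⊥, ⊤, bot_ne_top⟩, eq_bot_or_eq_top := fun W => ?_ }
      have := hirr (W.restrictScalars F) fun g w hw => by
        have h := W.smul_mem (TwistedGroupAlgebra.u α g) hw
        rwa [hsmul, η.toAlgHom_u] at h
      simpa using this
    exact ⟨V, _, _, hs, finrank_end_eq⟩
  · rintro ⟨V, _, _, hs, rfl⟩
    let _ : Module F V := Module.compHom V (algebraMap F (TwistedGroupAlgebra α))
    have : IsScalarTower F (TwistedGroupAlgebra α) V := IsScalarTower.of_compHom F _ V
    have : FiniteDimensional F (TwistedGroupAlgebra α) :=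
      (TwistedGroupAlgebra.u α).finiteDimensional_of_finite
    have : FiniteDimensional F V := Module.Finite.trans (TwistedGroupAlgebra α) V
    let ρ := Algebra.lsmul F F V (A := TwistedGroupAlgebra α)
    let η : ProjRep α V := ProjRep.ofEnd α (fun g => ρ (TwistedGroupAlgebra.u α g))
      (by rw [TwistedGroupAlgebra.u_one, map_smul, map_one]; rfl)
      (fun g h => by rw [← map_mul, TwistedGroupAlgebra.u_mul_u, map_smul])
    refine ⟨V, _, _, ‹_›, η, ⟨IsSimpleModule.nontrivial (TwistedGroupAlgebra α) V, fun W hW => ?_⟩,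
      finrank_end_eq.symm⟩
    let W' : Submodule (TwistedGroupAlgebra α) V :=
      { W with
        smul_mem' := fun a v hv => by
          induction (TwistedGroupAlgebra.u α).mem_span a using Submodule.span_induction with
          | mem a ha => obtain ⟨g, rfl⟩ := ha; exact hW g v hv
          | zero => rw [zero_smul]; exact W.zero_mem
          | add a b _ _ ha hb => rw [add_smul]; exact W.add_mem ha hb
          | smul c a _ ha => rw [smul_assoc]; exact W.smul_mem c ha }
    have hW' : W'.restrictScalars F = W := rfl
    rw [← hW']
    simpa using eq_bot_or_eq_top W'

theorem isSimpleModule_of_ringEquiv {A B V : Type*} [Ring A] [Ring B] [AddCommGroup V]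
    [Module A V] [Module B V] (e : A ≃+* B) (he : ∀ (a : A) (v : V), a • v = e a • v)
    [IsSimpleModule A V] : IsSimpleModule B V := by
  have := IsSimpleModule.nontrivial A V
  refine { exists_pair_ne := ⟨⊥, ⊤, bot_ne_top⟩, eq_bot_or_eq_top := fun W => ?_ }
  let W' : Submodule A V :=
    { W with smul_mem' := fun a v hv => by rw [he]; exact W.smul_mem _ hv }
  have h : ∀ v, v ∈ W' ↔ v ∈ W := fun _ => Iff.rfl
  rcases eq_bot_or_eq_top W' with h' | h'
  · exact Or.inl (by ext v; rw [← h, h', Submodule.mem_bot, Submodule.mem_bot])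
  · exact Or.inr (by ext v; rw [← h, h']; exact ⟨fun _ => trivial, fun _ => trivial⟩)

theorem finrank_end_eq_of_ringEquiv {A B V : Type*} [Ring A] [Ring B] [AddCommGroup V]
    [Module A V] [Module B V] (e : A ≃+* B) (he : ∀ (a : A) (v : V), a • v = e a • v) :
    finrank (Module.End B V) V = finrank (Module.End A V) V := by
  let i : Module.End B V → Module.End A V := fun f =>
    { toFun := f
      map_add' := map_add f
      map_smul' := fun a v => by rw [he, map_smul, RingHom.id_apply, he] }
  refine congrArg Cardinal.toNat (rank_eq_of_equiv_equiv i (AddEquiv.refl V) ⟨?_, ?_⟩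
    fun _ _ => rfl)
  · intro f g hfg
    ext v
    exact LinearMap.congr_fun hfg v
  · intro f
    exact ⟨{ toFun := f
             map_add' := map_add f
             map_smul' := fun b v => by
              rw [← e.apply_symm_apply b, ← he, map_smul, RingHom.id_apply, he] }, rfl⟩

theorem irrDims_subset_of_ringEquiv [IsAlgClosed F] [Finite G]
    (e : TwistedGroupAlgebra α ≃+* TwistedGroupAlgebra β) : irrDims α ⊆ irrDims β := by
  intro d hd
  obtain ⟨V, _, _, _, rfl⟩ := (mem_irrDims_iff d).1 hd
  let _ : Module (TwistedGroupAlgebra β) V := Module.compHom V e.symm.toRingHom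
  have he : ∀ (a : TwistedGroupAlgebra α) (v : V), a • v = e a • v := fun a v =>
    congrArg (· • v) (e.symm_apply_apply a).symm
  exact (mem_irrDims_iff _).2
    ⟨V, _, _, isSimpleModule_of_ringEquiv e he, finrank_end_eq_of_ringEquiv e he⟩

theorem dimGcd_eq_of_ringEquiv [IsAlgClosed F] [Finite G]
    (e : TwistedGroupAlgebra α ≃+* TwistedGroupAlgebra β) : dimGcd α = dimGcd β :=
  congrArg setGcd ((irrDims_subset_of_ringEquiv e).antisymm (irrDims_subset_of_ringEquiv e.symm))

end Irreducible

end TwistedGroup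

theorem mainTheorem5 {G : Type} [Group G] [Finite G] (α : TwistedGroup.Cocycle ℂ G)
    (n : ℕ) (hn : addOrderOf α.cls = n) (r : ℕ) :
    (Nat.gcd r n = 1 →
      Nonempty (TwistedGroup.TwistedGroupAlgebra α ≃ₐ[ℂ]
        TwistedGroup.TwistedGroupAlgebra (r • α))) ∧
    (Nat.gcd r n ≠ 1 →
      TwistedGroup.dimGcd α > TwistedGroup.dimGcd (r • α)) ∧
    (Nonempty (TwistedGroup.TwistedGroupAlgebra α ≃ₐ[ℂ]
        TwistedGroup.TwistedGroupAlgebra (r • α)) ↔ Nat.gcd n r = 1) ∧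
    (Nonempty (TwistedGroup.TwistedGroupAlgebra α ≃+*
        TwistedGroup.TwistedGroupAlgebra (r • α)) ↔ Nat.gcd n r = 1) := by
  subst hn
  rw [Nat.gcd_comm _ r]
  have h1 := TwistedGroup.nonempty_algEquiv_nsmul α (r := r)
  have h2 := TwistedGroup.dimGcd_nsmul_lt α r
  have h3 : Nonempty (TwistedGroup.TwistedGroupAlgebra α ≃+*
      TwistedGroup.TwistedGroupAlgebra (r • α)) → Nat.gcd r (addOrderOf α.cls) = 1 := by
    rintro ⟨e⟩
    by_contra hne
    exact (h2 hne).ne' (TwistedGroup.dimGcd_eq_of_ringEquiv e)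
  exact ⟨h1, h2, ⟨fun ⟨e⟩ => h3 ⟨e.toRingEquiv⟩, h1⟩,
    ⟨h3, fun h => (h1 h).map AlgEquiv.toRingEquiv⟩⟩
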